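/- Let $\Gamma$ be a finite simplicial complex whose vertex set $V$ has $n$ elements, and let $G=\Gamma^{(1)}$ be its 1-skeleton, regarded as a simple graph on $V$. A \emph{flat} of $G$ is a set $F$ of edges of $G$ such that each connected component of the graph $(V,F)$ is an induced subgraph of $G$; write $\mathcal F(G)$ for the set of flats, $c(F)$ for the number of connected components of $(V,F)$, $G/F$ for the graph obtained from $G$ by contracting the edges in $F$, and $a(H)$ for the number of acyclic orientations of a graph $H$. Then $$(-1)^n=\sum_{F\in\mathcal F(\Gamma^{(1)})}(-1)^{c(F)}\,a(\Gamma^{(1)}/F).$$ Moreover, let $\mathbb K$ be a field and let $\mathcal A$ be the Hopf algebra of simplicial complexes over $\mathbb K$: the $\mathbb K$-vector space with basis the isomorphism classes $[\Gamma]$ of finite simplicial complexes, with product $[\Gamma]\cdot[\Theta]=[\Gamma\uplus\Theta]$ (disjoint union), unit $[\varnothing]$ (the complex without vertices), coproduct $\Delta([\Gamma])=\sum_{T\subseteq V(\Gamma)}[\Gamma_T]\otimes[\Gamma_{V(\Gamma)- T}]$ (where $\Gamma_T$ is the complex induced on $T$), counit $\epsilon([\Gamma])=\delta_{[\Gamma],[\varnothing]}$,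 and antipode $S$. Then the coefficients of $S([\Gamma])$ in the basis of isomorphism classes sum to $(-1)^n$ in $\mathbb K$. -/

import Mathlib

open scoped TensorProduct

/-! ### Graphs: flats, contraction, acyclic orientations -/

namespace SimpleGraph

/-- The spanning subgraph of `G` with edge set `F`, for a set `F` of edges of `G`,
is `SimpleGraph.fromEdgeSet F`. A set `F` of edges of `G` is a *flat* of `G` if every connected
component of that spanning subgraph is an induced subgraph of `G`. -/
def IsFlat {V : Type*} (G : SimpleGraph V) (F : Set (Sym2 V)) : Prop :=
  F ⊆ G.edgeSet ∧
    ∀ c : (fromEdgeSet F).ConnectedComponent,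
      (fromEdgeSet F).induce c.supp = G.induce c.supp

/-- The finite set of all flats of a graph on a finite vertex set. -/
noncomputable def flats {V : Type*} [Finite V] (G : SimpleGraph V) : Finset (Set (Sym2 V)) :=
  (Set.toFinite {F : Set (Sym2 V) | G.IsFlat F}).toFinset

/-- `c(F)`: the number of connected components of the graph with vertex set `V` and
edge set `F`. -/
noncomputable def numComponents {V : Type*} (F : Set (Sym2 V)) : ℕ :=
  Nat.card (fromEdgeSet F).ConnectedComponent

/-- The contraction `G / F`: the vertices are the connected components of the graph `(V, F)`, two
different ones being adjacent when an edge of `G` joins them. (Parallel edges are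
merged, as usual for simple graphs; in an acyclic orientation they all point the same way.) -/
def contract {V : Type*} (G : SimpleGraph V) (F : Set (Sym2 V)) :
    SimpleGraph (fromEdgeSet F).ConnectedComponent where
  Adj c d := c ≠ d ∧ ∃ v w : V, v ∈ c.supp ∧ w ∈ d.supp ∧ G.Adj v w
  symm := ⟨fun _ _ ⟨h, v, w, hv, hw, a⟩ => ⟨h.symm, w, v, hw, hv, a.symm⟩⟩
  loopless := ⟨fun _ h => h.1 rfl⟩

/-- `D` is an orientation of `G`: it chooses exactly one direction of every edge of `G` and has
no other arcs. -/
def IsOrientation {V : Type*} (G : SimpleGraph V) (D : Digraph V) : Prop :=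
  (∀ v w, G.Adj v w ↔ D.Adj v w ∨ D.Adj w v) ∧ ∀ v w, D.Adj v w → ¬ D.Adj w v

/-- `a(G)`: the number of orientations of `G` without directed cycles, that is, such that
no vertex can be reached from itself along a nonempty directed path. -/
noncomputable def numAcyclicOrientations {V : Type*} (G : SimpleGraph V) : ℕ :=
  Nat.card {D : Digraph V // G.IsOrientation D ∧ ∀ v, ¬ Relation.TransGen D.Adj v v}

end SimpleGraph

/-! ### Simplicial complexes -/

namespace AbstractSimplicialComplex

variable {V W X : Type*}

/-- The 1-skeleton of a simplicial complex, as a simple graph. -/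
def oneSkeleton (K : AbstractSimplicialComplex V) : SimpleGraph V where
  Adj v w := v ≠ w ∧ ∃ s ∈ K.faces, (s : Set V) = {v, w}
  symm := ⟨fun v w ⟨h, s, hs, e⟩ => ⟨h.symm, s, hs, e.trans (Set.pair_comm v w)⟩⟩
  loopless := ⟨fun _ h => h.1 rfl⟩

/-- The complex on `W` obtained by pulling back along an injection `W ↪ V`. -/
def comap (K : AbstractSimplicialComplex V) (f : W ↪ V) : AbstractSimplicialComplex W where
  faces := {s | s.map f ∈ K.faces}
  isRelLowerSet_faces := fun s hs =>
    ⟨Finset.map_nonempty.mp (K.isRelLowerSet_faces hs).1, fun _ hts ht =>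
      (K.isRelLowerSet_faces hs).2 (Finset.map_subset_map.mpr hts) (Finset.map_nonempty.mpr ht)⟩
  singleton_mem v := by simpa using K.singleton_mem (f v)

/-- The induced complex on a set `T` of vertices: its faces are the faces of `K` inside `T`. -/
def induce (K : AbstractSimplicialComplex V) (T : Finset V) : AbstractSimplicialComplex T :=
  K.comap (Function.Embedding.subtype (· ∈ T))

/-- The disjoint union of two complexes. -/
def disjUnion (K : AbstractSimplicialComplex V) (L : AbstractSimplicialComplex W) :
    AbstractSimplicialComplex (V ⊕ W) where
  faces := (fun s => s.map Function.Embedding.inl) '' K.faces ∪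
    (fun s => s.map Function.Embedding.inr) '' L.faces
  isRelLowerSet_faces := by
    rintro _ (⟨s, hs, rfl⟩ | ⟨s, hs, rfl⟩)
    · refine ⟨Finset.map_nonempty.mpr (K.isRelLowerSet_faces hs).1, fun t hts ht => ?_⟩
      obtain ⟨u, hu, rfl⟩ := Finset.subset_map_iff.mp hts
      exact Or.inl ⟨u, (K.isRelLowerSet_faces hs).2 hu (Finset.map_nonempty.mp ht), rfl⟩
    · refine ⟨Finset.map_nonempty.mpr (L.isRelLowerSet_faces hs).1, fun t hts ht => ?_⟩
      obtain ⟨u, hu, rfl⟩ := Finset.subset_map_iff.mp hts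
      exact Or.inr ⟨u, (L.isRelLowerSet_faces hs).2 hu (Finset.map_nonempty.mp ht), rfl⟩
  singleton_mem v := by
    rcases v with v | v
    · exact Or.inl ⟨{v}, K.singleton_mem v, rfl⟩
    · exact Or.inr ⟨{v}, L.singleton_mem v, rfl⟩

/-- Two complexes are isomorphic if a bijection of the vertices matches the faces. -/
def Iso (K : AbstractSimplicialComplex V) (L : AbstractSimplicialComplex W) : Prop :=
  ∃ e : V ≃ W, ∀ s : Finset V, s ∈ K.faces ↔ s.map e.toEmbedding ∈ L.faces

theorem Iso.refl (K : AbstractSimplicialComplex V) : K.Iso K :=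
  ⟨Equiv.refl V, fun s => by simp⟩

theorem Iso.symm {K : AbstractSimplicialComplex V} {L : AbstractSimplicialComplex W}
    (h : K.Iso L) : L.Iso K := by
  obtain ⟨e, he⟩ := h
  refine ⟨e.symm, fun s => ?_⟩
  rw [he, Finset.map_map]
  simp

theorem Iso.trans {K : AbstractSimplicialComplex V} {L : AbstractSimplicialComplex W}
    {M : AbstractSimplicialComplex X} (h : K.Iso L) (h' : L.Iso M) : K.Iso M := by
  obtain ⟨e, he⟩ := h
  obtain ⟨e', he'⟩ := h'
  refine ⟨e.trans e', fun s => ?_⟩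
  rw [he, he', Finset.map_map]
  rfl

theorem Iso.of_maps {K : AbstractSimplicialComplex V} {L : AbstractSimplicialComplex W}
    (e : V ≃ W) (h : ∀ s ∈ K.faces, s.map e.toEmbedding ∈ L.faces)
    (h' : ∀ s ∈ L.faces, s.map e.symm.toEmbedding ∈ K.faces) : K.Iso L := by
  refine ⟨e, fun s => ⟨h s, fun hs => ?_⟩⟩
  have := h' _ hs
  rwa [Finset.map_map, show e.toEmbedding.trans e.symm.toEmbedding = Function.Embedding.refl V from
    by ext; simp, Finset.map_refl] at this

theorem comap_comap (K : AbstractSimplicialComplex V) (f : W ↪ V) (g : X ↪ W) :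
    (K.comap f).comap g = K.comap (g.trans f) := by
  ext s
  simp [comap, Finset.map_map]

theorem comap_iso_of_range_eq {W' : Type*} (K : AbstractSimplicialComplex V) (f : W ↪ V)
    (g : W' ↪ V) (h : Set.range f = Set.range g) : (K.comap f).Iso (K.comap g) := by
  let e : W ≃ W' := (Equiv.ofInjective f f.injective).trans
    ((Equiv.setCongr h).trans (Equiv.ofInjective g g.injective).symm)
  have he : e.toEmbedding.trans g = f := by
    ext w
    exact Equiv.apply_ofInjective_symm g.injective _
  refine ⟨e, fun s => ?_⟩
  change s.map f ∈ K.faces ↔ (s.map e.toEmbedding).map g ∈ K.faces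
  rw [Finset.map_map, he]

theorem iso_comap_equiv (K : AbstractSimplicialComplex V) (e : W ≃ V) :
    (K.comap e.toEmbedding).Iso K := ⟨e, fun _ => Iff.rfl⟩

theorem Iso.eq_comap {K : AbstractSimplicialComplex V} {L : AbstractSimplicialComplex W}
    (h : K.Iso L) : ∃ e : V ≃ W, K = L.comap e.toEmbedding := by
  obtain ⟨e, he⟩ := h
  exact ⟨e, by ext s; exact he s⟩

theorem iso_of_isEmpty [IsEmpty V] [IsEmpty W] (K : AbstractSimplicialComplex V)
    (L : AbstractSimplicialComplex W) : K.Iso L := by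
  refine .of_maps (Equiv.equivOfIsEmpty V W) (fun s hs => ?_) (fun s hs => ?_)
  · exact absurd (K.isRelLowerSet_faces hs).1 (by simp [Finset.eq_empty_of_isEmpty s])
  · exact absurd (L.isRelLowerSet_faces hs).1 (by simp [Finset.eq_empty_of_isEmpty s])

theorem Iso.disjUnion {V' W' : Type*} {K : AbstractSimplicialComplex V}
    {L : AbstractSimplicialComplex W} {K' : AbstractSimplicialComplex V'}
    {L' : AbstractSimplicialComplex W'} (hK : K.Iso K') (hL : L.Iso L') :
    (K.disjUnion L).Iso (K'.disjUnion L') := by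
  obtain ⟨e, he⟩ := hK
  obtain ⟨f, hf⟩ := hL
  refine .of_maps (Equiv.sumCongr e f) ?_ ?_
  · rintro _ (⟨s, hs, rfl⟩ | ⟨s, hs, rfl⟩)
    · exact Or.inl ⟨_, (he s).mp hs, by simp only [Finset.map_map]; rfl⟩
    · exact Or.inr ⟨_, (hf s).mp hs, by simp only [Finset.map_map]; rfl⟩
  · rintro _ (⟨s, hs, rfl⟩ | ⟨s, hs, rfl⟩)
    · exact Or.inl ⟨s.map e.symm.toEmbedding, (he _).mpr (by simpa [Finset.map_map] using hs),
        by simp only [Finset.map_map]; rfl⟩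
    · exact Or.inr ⟨s.map f.symm.toEmbedding, (hf _).mpr (by simpa [Finset.map_map] using hs),
        by simp only [Finset.map_map]; rfl⟩

theorem disjUnion_comm_iso (K : AbstractSimplicialComplex V) (L : AbstractSimplicialComplex W) :
    (K.disjUnion L).Iso (L.disjUnion K) := by
  refine .of_maps (Equiv.sumComm V W) ?_ ?_
  · rintro _ (⟨s, hs, rfl⟩ | ⟨s, hs, rfl⟩)
    · exact Or.inr ⟨s, hs, by simp only [Finset.map_map]; rfl⟩
    · exact Or.inl ⟨s, hs, by simp only [Finset.map_map]; rfl⟩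
  · rintro _ (⟨s, hs, rfl⟩ | ⟨s, hs, rfl⟩)
    · exact Or.inr ⟨s, hs, by simp only [Finset.map_map]; rfl⟩
    · exact Or.inl ⟨s, hs, by simp only [Finset.map_map]; rfl⟩

theorem disjUnion_assoc_iso (K : AbstractSimplicialComplex V) (L : AbstractSimplicialComplex W)
    (M : AbstractSimplicialComplex X) :
    ((K.disjUnion L).disjUnion M).Iso (K.disjUnion (L.disjUnion M)) := by
  refine .of_maps (Equiv.sumAssoc V W X) ?_ ?_
  · rintro _ (⟨_, ⟨s, hs, rfl⟩ | ⟨s, hs, rfl⟩, rfl⟩ | ⟨s, hs, rfl⟩)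
    · exact Or.inl ⟨s, hs, by simp only [Finset.map_map]; rfl⟩
    · exact Or.inr ⟨_, Or.inl ⟨s, hs, rfl⟩, by simp only [Finset.map_map]; rfl⟩
    · exact Or.inr ⟨_, Or.inr ⟨s, hs, rfl⟩, by simp only [Finset.map_map]; rfl⟩
  · rintro _ (⟨s, hs, rfl⟩ | ⟨_, ⟨s, hs, rfl⟩ | ⟨s, hs, rfl⟩, rfl⟩)
    · exact Or.inl ⟨_, Or.inl ⟨s, hs, rfl⟩, by simp only [Finset.map_map]; rfl⟩
    · exact Or.inl ⟨_, Or.inr ⟨s, hs, rfl⟩, by simp only [Finset.map_map]; rfl⟩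
    · exact Or.inr ⟨s, hs, by simp only [Finset.map_map]; rfl⟩

theorem disjUnion_empty_iso [IsEmpty W] (K : AbstractSimplicialComplex V)
    (L : AbstractSimplicialComplex W) : (K.disjUnion L).Iso K := by
  refine .of_maps (Equiv.sumEmpty V W) ?_ ?_
  · rintro _ (⟨s, hs, rfl⟩ | ⟨s, hs, rfl⟩)
    · rw [Finset.map_map]
      convert hs
      ext; simp
    · exact absurd (L.isRelLowerSet_faces hs).1 (by simp [Finset.eq_empty_of_isEmpty s])
  · intro s hs
    exact Or.inl ⟨s, hs, rfl⟩

theorem induce_disjUnion_iso (K : AbstractSimplicialComplex V) (L : AbstractSimplicialComplex W)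
    (S : Finset V) (T : Finset W) :
    ((K.disjUnion L).induce (S.disjSum T)).Iso ((K.induce S).disjUnion (L.induce T)) := by
  let f : S ⊕ T ↪ V ⊕ W := Function.Embedding.sumMap (Function.Embedding.subtype (· ∈ S))
    (Function.Embedding.subtype (· ∈ T))
  have h : (K.induce S).disjUnion (L.induce T) = (K.disjUnion L).comap f := by
    ext s
    constructor
    · rintro (⟨s, hs, rfl⟩ | ⟨s, hs, rfl⟩)
      · exact Or.inl ⟨_, hs, by simp only [Finset.map_map]; rfl⟩
      · exact Or.inr ⟨_, hs, by simp only [Finset.map_map]; rfl⟩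
    · have key := (Finset.toLeft_disjSum_toRight (u := s))
      rintro (⟨t, ht, hts⟩ | ⟨t, ht, hts⟩)
      · have hr : s.toRight = ∅ := by
          refine Finset.eq_empty_of_forall_notMem fun x hx => ?_
          have : f (Sum.inr x) ∈ s.map f := Finset.mem_map_of_mem _ (Finset.mem_toRight.mp hx)
          rw [← hts] at this
          simp [f] at this
        rw [hr, Finset.disjSum_empty] at key
        refine Or.inl ⟨s.toLeft, ?_, key⟩
        change s.toLeft.map _ ∈ K.faces
        convert ht
        apply Finset.map_injective (Function.Embedding.inl : V ↪ V ⊕ W)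
        dsimp only at hts
        refine Eq.trans ?_ hts.symm
        conv_rhs => rw [← key]
        simp only [Finset.map_map]
        rfl
      · have hr : s.toLeft = ∅ := by
          refine Finset.eq_empty_of_forall_notMem fun x hx => ?_
          have : f (Sum.inl x) ∈ s.map f := Finset.mem_map_of_mem _ (Finset.mem_toLeft.mp hx)
          rw [← hts] at this
          simp [f] at this
        rw [hr, Finset.empty_disjSum] at key
        refine Or.inr ⟨s.toRight, ?_, key⟩
        change s.toRight.map _ ∈ L.faces
        convert ht
        apply Finset.map_injective (Function.Embedding.inr : W ↪ V ⊕ W)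
        dsimp only at hts
        refine Eq.trans ?_ hts.symm
        conv_rhs => rw [← key]
        simp only [Finset.map_map]
        rfl
  rw [h]
  refine comap_iso_of_range_eq _ _ _ ?_
  ext x
  rcases x with x | x <;> simp [f]

instance isoSetoid : Setoid (Σ n : ℕ, AbstractSimplicialComplex (Fin n)) where
  r p q := p.2.Iso q.2
  iseqv := ⟨fun p => Iso.refl p.2, fun h => Iso.symm h, fun h h' => Iso.trans h h'⟩

end AbstractSimplicialComplex

open AbstractSimplicialComplex

/-- The isomorphism classes of finite simplicial complexes (each has a representative on some
`Fin n`). -/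
def ComplexClass : Type := Quotient AbstractSimplicialComplex.isoSetoid

namespace ComplexClass

/-- The isomorphism class `[K]` of a simplicial complex on a finite vertex set. -/
noncomputable def mk {V : Type*} [Finite V] (K : AbstractSimplicialComplex V) : ComplexClass :=
  Quotient.mk _ ⟨Nat.card V, K.comap (Finite.equivFin V).symm.toEmbedding⟩

theorem mk_eq_iff {V W : Type*} [Finite V] [Finite W] {K : AbstractSimplicialComplex V}
    {L : AbstractSimplicialComplex W} : mk K = mk L ↔ K.Iso L := by
  refine Quotient.eq.trans ⟨fun h => ?_, fun h => ?_⟩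
  · exact ((iso_comap_equiv K _).symm.trans h).trans (iso_comap_equiv L _)
  · exact ((iso_comap_equiv K _).trans h).trans (iso_comap_equiv L _).symm

theorem mk_fin {n : ℕ} (K : AbstractSimplicialComplex (Fin n)) :
    (Quotient.mk _ ⟨n, K⟩ : ComplexClass) = mk K :=
  Quotient.sound (iso_comap_equiv K _).symm

theorem ind {p : ComplexClass → Prop}
    (h : ∀ (n : ℕ) (K : AbstractSimplicialComplex (Fin n)), p (mk K)) (x : ComplexClass) : p x := by
  induction x using Quotient.inductionOn with
  | h a =>
    obtain ⟨n, K⟩ := a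
    rw [mk_fin]
    exact h n K

/-- The number of vertices. -/
def degree : ComplexClass → ℕ :=
  Quotient.lift Sigma.fst fun p q (h : p.2.Iso q.2) => by
    obtain ⟨e, -⟩ := h
    simpa using Fintype.card_congr e

theorem degree_mk {V : Type*} [Finite V] (K : AbstractSimplicialComplex V) :
    (mk K).degree = Nat.card V := rfl

/-- Disjoint union of isomorphism classes. -/
noncomputable instance : Mul ComplexClass where
  mul := Quotient.lift₂ (fun p q => mk (p.2.disjUnion q.2))
    fun _ _ _ _ h h' => mk_eq_iff.mpr (Iso.disjUnion h h')

/-- The class of the complex without vertices. -/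
noncomputable instance : One ComplexClass where
  one := mk (⊥ : AbstractSimplicialComplex (Fin 0))

theorem mk_mul_mk {V W : Type*} [Finite V] [Finite W] (K : AbstractSimplicialComplex V)
    (L : AbstractSimplicialComplex W) : mk K * mk L = mk (K.disjUnion L) :=
  mk_eq_iff.mpr ((iso_comap_equiv K _).disjUnion (iso_comap_equiv L _))

theorem mk_eq_one {V : Type*} [Finite V] [IsEmpty V] (K : AbstractSimplicialComplex V) :
    mk K = 1 :=
  mk_eq_iff.mpr (iso_of_isEmpty K _)

theorem degree_eq_zero_iff {x : ComplexClass} : x.degree = 0 ↔ x = 1 := by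
  constructor
  · induction x using ind with
    | h n K =>
      intro h
      have : n = 0 := by simpa [degree_mk] using h
      subst this
      exact mk_eq_one K
  · rintro rfl
    exact (degree_mk _).trans (by simp)

noncomputable instance : CommMonoid ComplexClass where
  mul_assoc x y z := by
    induction x using ind with
    | h _ K =>
    induction y using ind with
    | h _ L =>
    induction z using ind with
    | h _ M =>
    simp only [mk_mul_mk]
    exact mk_eq_iff.mpr (disjUnion_assoc_iso K L M)
  mul_comm x y := by
    induction x using ind with
    | h _ K =>
    induction y using ind with
    | h _ L =>
    simp only [mk_mul_mk]
    exact mk_eq_iff.mpr (disjUnion_comm_iso K L)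
  mul_one x := by
    induction x using ind with
    | h _ K => exact (mk_mul_mk K _).trans (mk_eq_iff.mpr (disjUnion_empty_iso K _))
  one_mul x := by
    induction x using ind with
    | h _ K =>
      exact (mk_mul_mk _ K).trans (mk_eq_iff.mpr
        ((disjUnion_comm_iso _ K).trans (disjUnion_empty_iso K _)))

theorem degree_mul (x y : ComplexClass) : (x * y).degree = x.degree + y.degree := by
  induction x using ind with
  | h _ K =>
  induction y using ind with
  | h _ L =>
  simp [mk_mul_mk, degree_mk]

theorem mk_induce_univ {V : Type*} [Fintype V] (K : AbstractSimplicialComplex V) :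
    mk (K.induce Finset.univ) = mk K := by
  refine mk_eq_iff.mpr ((comap_iso_of_range_eq K _ (Equiv.refl V).toEmbedding ?_).trans
    (iso_comap_equiv K _))
  ext x
  simp

theorem mk_induce_empty {V : Type*} (K : AbstractSimplicialComplex V) :
    mk (K.induce ∅) = 1 := mk_eq_one _

/-- Inducing twice. -/
theorem mk_induce_induce {V : Type*} (K : AbstractSimplicialComplex V) (T : Finset V)
    (U : Finset T) (S : Finset V) (h : U.map (Function.Embedding.subtype _) = S) :
    mk ((K.induce T).induce U) = mk (K.induce S) := by
  subst h
  rw [induce, induce, comap_comap]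
  refine mk_eq_iff.mpr (comap_iso_of_range_eq K _ _ ?_)
  ext x
  simp

end ComplexClass

/-! ### The Hopf algebra of simplicial complexes -/

/-- The algebra of finite simplicial complexes over `𝕜`: the vector space whose basis is the set of
isomorphism classes, with disjoint union as multiplication. -/
def ComplexAlgebra (𝕜 : Type*) [Field 𝕜] : Type _ := MonoidAlgebra 𝕜 ComplexClass

namespace ComplexAlgebra

variable (𝕜 : Type*) [Field 𝕜]

noncomputable instance : CommRing (ComplexAlgebra 𝕜) :=
  inferInstanceAs (CommRing (MonoidAlgebra 𝕜 ComplexClass))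

noncomputable instance : Algebra 𝕜 (ComplexAlgebra 𝕜) :=
  inferInstanceAs (Algebra 𝕜 (MonoidAlgebra 𝕜 ComplexClass))

/-- The basis element of an isomorphism class. -/
noncomputable def single : ComplexClass →* ComplexAlgebra 𝕜 := MonoidAlgebra.of 𝕜 ComplexClass

/-- The basis element `[K]`. -/
noncomputable def basis {V : Type*} [Finite V] (K : AbstractSimplicialComplex V) :
    ComplexAlgebra 𝕜 := single 𝕜 (ComplexClass.mk K)

/-- The coefficients of an element in the basis of isomorphism classes. -/
def coeffs (x : ComplexAlgebra 𝕜) : ComplexClass →₀ 𝕜 := MonoidAlgebra.coeff x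

/-- The (finite) sum of the coefficients of an element in the basis of isomorphism classes. -/
def coeffSum (x : ComplexAlgebra 𝕜) : 𝕜 := (coeffs 𝕜 x).sum fun _ r => r

/-- The linear map with prescribed values on the basis. -/
noncomputable def liftLinear {M : Type*} [AddCommGroup M] [Module 𝕜 M] (f : ComplexClass → M) :
    ComplexAlgebra 𝕜 →ₗ[𝕜] M :=
  Finsupp.linearCombination 𝕜 f ∘ₗ
    (MonoidAlgebra.coeffLinearEquiv 𝕜 :
      MonoidAlgebra 𝕜 ComplexClass ≃ₗ[𝕜] ComplexClass →₀ 𝕜).toLinearMap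

theorem liftLinear_single {M : Type*} [AddCommGroup M] [Module 𝕜 M] (f : ComplexClass → M)
    (x : ComplexClass) : liftLinear 𝕜 f (single 𝕜 x) = f x := by
  change Finsupp.linearCombination 𝕜 f (Finsupp.single x 1) = f x
  simp

/-- The algebra homomorphism with prescribed multiplicative values on the basis. -/
noncomputable def liftAlg {B : Type*} [CommRing B] [Algebra 𝕜 B] (f : ComplexClass →* B) :
    ComplexAlgebra 𝕜 →ₐ[𝕜] B := MonoidAlgebra.lift 𝕜 B ComplexClass f

theorem liftAlg_single {B : Type*} [CommRing B] [Algebra 𝕜 B] (f : ComplexClass →* B)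
    (x : ComplexClass) : liftAlg 𝕜 f (single 𝕜 x) = f x :=
  MonoidAlgebra.lift_of f x

variable {𝕜} in
theorem linearMap_ext {M : Type*} [AddCommGroup M] [Module 𝕜 M]
    {f g : ComplexAlgebra 𝕜 →ₗ[𝕜] M}
    (h : ∀ (n : ℕ) (K : AbstractSimplicialComplex (Fin n)), f (basis 𝕜 K) = g (basis 𝕜 K)) :
    f = g := by
  have hx : ∀ x, f (single 𝕜 x) = g (single 𝕜 x) := fun x => by
    induction x using ComplexClass.ind with
    | h n K => exact h n K
  refine LinearMap.ext fun a => ?_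
  induction a using MonoidAlgebra.induction_on with
  | of x => exact hx x
  | add a b ha hb => exact (map_add f a b).trans ((congrArg₂ _ ha hb).trans (map_add g a b).symm)
  | smul r a ha => exact (map_smul f r a).trans ((congrArg _ ha).trans (map_smul g r a).symm)

variable {𝕜} in
theorem algHom_ext {B : Type*} [CommRing B] [Algebra 𝕜 B] {f g : ComplexAlgebra 𝕜 →ₐ[𝕜] B}
    (h : ∀ (n : ℕ) (K : AbstractSimplicialComplex (Fin n)), f (basis 𝕜 K) = g (basis 𝕜 K)) :
    f = g :=
  AlgHom.toLinearMap_injective (linearMap_ext h)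

/-- `∑_{T ⊆ V} [K_T] ⊗ [K_{V - T}]`. -/
noncomputable def comulSum {V : Type*} [Fintype V] [DecidableEq V]
    (K : AbstractSimplicialComplex V) : ComplexAlgebra 𝕜 ⊗[𝕜] ComplexAlgebra 𝕜 :=
  ∑ T : Finset V, basis 𝕜 (K.induce T) ⊗ₜ[𝕜] basis 𝕜 (K.induce Tᶜ)

theorem comulSum_congr {V W : Type*} [Fintype V] [DecidableEq V] [Fintype W] [DecidableEq W]
    {K : AbstractSimplicialComplex V} {L : AbstractSimplicialComplex W} (h : K.Iso L) :
    comulSum 𝕜 K = comulSum 𝕜 L := by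
  obtain ⟨e, rfl⟩ := h.eq_comap
  refine Fintype.sum_equiv e.finsetCongr _ _ fun T => ?_
  have aux : ∀ (T : Finset V) (S : Finset W), (∀ w, w ∈ S ↔ e.symm w ∈ T) →
      basis 𝕜 ((L.comap e.toEmbedding).induce T) = basis 𝕜 (L.induce S) := fun T S hTS => by
    refine congrArg (single 𝕜) (ComplexClass.mk_eq_iff.mpr ?_)
    rw [induce, comap_comap]
    refine comap_iso_of_range_eq _ _ _ ?_
    ext w
    simp [hTS, ← e.eq_symm_apply]
  rw [aux T (e.finsetCongr T) fun w => by simp,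
    aux Tᶜ (e.finsetCongr T)ᶜ fun w => by simp]

/-- The coproduct on basis elements. -/
noncomputable def comulBasis : ComplexClass → ComplexAlgebra 𝕜 ⊗[𝕜] ComplexAlgebra 𝕜 :=
  Quotient.lift (fun p => comulSum 𝕜 p.2) fun _ _ h => comulSum_congr 𝕜 h

theorem comulBasis_mk {V : Type*} [Fintype V] [DecidableEq V]
    (K : AbstractSimplicialComplex V) : comulBasis 𝕜 (ComplexClass.mk K) = comulSum 𝕜 K :=
  comulSum_congr 𝕜 (iso_comap_equiv K _)

theorem comulBasis_one : comulBasis 𝕜 1 = 1 := by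
  refine (comulBasis_mk 𝕜 _).trans ?_
  simp only [comulSum, basis]
  simp [ComplexClass.mk_eq_one, Algebra.TensorProduct.one_def]

theorem comulBasis_mul (x y : ComplexClass) :
    comulBasis 𝕜 (x * y) = comulBasis 𝕜 x * comulBasis 𝕜 y := by
  induction x using ComplexClass.ind with
  | h _ K =>
  induction y using ComplexClass.ind with
  | h _ L =>
  rw [ComplexClass.mk_mul_mk, comulBasis_mk, comulBasis_mk, comulBasis_mk, comulSum, comulSum,
    comulSum, Finset.sum_mul_sum, ← Fintype.sum_prod_type']
  refine (Fintype.sum_equiv Finset.sumEquiv.symm.toEquiv _ _ fun p => ?_).symm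
  have hc : (p.1.disjSum p.2)ᶜ = p.1ᶜ.disjSum p.2ᶜ := by
    ext x
    rcases x with x | x <;> simp
  have aux := fun S T => congrArg (single 𝕜)
    ((ComplexClass.mk_eq_iff.mpr (induce_disjUnion_iso K L S T)).trans
      (ComplexClass.mk_mul_mk _ _).symm)
  change _ = basis 𝕜 ((K.disjUnion L).induce (p.1.disjSum p.2)) ⊗ₜ
    basis 𝕜 ((K.disjUnion L).induce (p.1.disjSum p.2)ᶜ)
  rw [hc, Algebra.TensorProduct.tmul_mul_tmul]
  simp only [basis, aux, map_mul]

/-- The coproduct `[K] ↦ ∑_{T ⊆ V} [K_T] ⊗ [K_{V - T}]`. -/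
noncomputable def comulHom : ComplexAlgebra 𝕜 →ₐ[𝕜] ComplexAlgebra 𝕜 ⊗[𝕜] ComplexAlgebra 𝕜 :=
  liftAlg 𝕜 ⟨⟨comulBasis 𝕜, comulBasis_one 𝕜⟩, comulBasis_mul 𝕜⟩

open Classical in
/-- The counit: `1` on the class of the complex without vertices, `0` on all other classes. -/
noncomputable def counitHom : ComplexAlgebra 𝕜 →ₐ[𝕜] 𝕜 :=
  liftAlg 𝕜
    { toFun := fun x => if x = 1 then 1 else 0
      map_one' := if_pos rfl
      map_mul' := fun x y => by
        simp only [← ComplexClass.degree_eq_zero_iff, ComplexClass.degree_mul, Nat.add_eq_zero_iff]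
        split_ifs <;> simp_all }

theorem comulHom_basis {V : Type*} [Fintype V] [DecidableEq V]
    (K : AbstractSimplicialComplex V) :
    comulHom 𝕜 (basis 𝕜 K) =
      ∑ T : Finset V, basis 𝕜 (K.induce T) ⊗ₜ[𝕜] basis 𝕜 (K.induce Tᶜ) :=
  (liftAlg_single 𝕜 _ _).trans (comulBasis_mk 𝕜 K)

theorem counitHom_basis {V : Type*} [Fintype V] (K : AbstractSimplicialComplex V) :
    counitHom 𝕜 (basis 𝕜 K) = if Fintype.card V = 0 then 1 else 0 := by
  refine (liftAlg_single 𝕜 _ _).trans ?_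
  simp [← ComplexClass.degree_eq_zero_iff, ComplexClass.degree_mk]

theorem basis_congr {V : Type*} (K : AbstractSimplicialComplex V) {S T : Finset V} (h : S = T) :
    basis 𝕜 (K.induce S) = basis 𝕜 (K.induce T) := by
  subst h
  rfl

theorem basis_induce_univ {V : Type*} [Fintype V] (K : AbstractSimplicialComplex V) :
    basis 𝕜 (K.induce Finset.univ) = basis 𝕜 K :=
  congrArg (single 𝕜) (ComplexClass.mk_induce_univ K)

theorem basis_induce_empty {V : Type*} (K : AbstractSimplicialComplex V) :
    basis 𝕜 (K.induce ∅) = 1 :=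
  (congrArg (single 𝕜) (ComplexClass.mk_induce_empty K)).trans (map_one _)

/-- The coproduct of an induced complex, in terms of induced complexes of the big one. -/
theorem comulHom_induce {V : Type*} [DecidableEq V] (K : AbstractSimplicialComplex V)
    (T : Finset V) :
    comulHom 𝕜 (basis 𝕜 (K.induce T)) =
      ∑ U ∈ T.powerset, basis 𝕜 (K.induce U) ⊗ₜ[𝕜] basis 𝕜 (K.induce (T \ U)) := by
  rw [comulHom_basis]
  refine Finset.sum_bij (fun U _ => U.map (Function.Embedding.subtype _)) (fun U _ => ?_)
    (fun U _ U' _ h => Finset.map_injective _ h) (fun U hU => ?_) (fun U _ => ?_)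
  · rw [Finset.mem_powerset]
    intro x hx
    obtain ⟨y, -, rfl⟩ := Finset.mem_map.mp hx
    exact y.2
  · refine ⟨U.subtype (· ∈ T), Finset.mem_univ _, ?_⟩
    exact Finset.subtype_map_of_mem fun x hx => Finset.mem_powerset.mp hU hx
  · congr 1
    · exact congrArg (single 𝕜) (ComplexClass.mk_induce_induce K T U _ rfl)
    · refine congrArg (single 𝕜) (ComplexClass.mk_induce_induce K T _ _ ?_)
      ext x
      by_cases hx : x ∈ T <;> simp [hx]

noncomputable instance : Bialgebra 𝕜 (ComplexAlgebra 𝕜) :=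
  Bialgebra.ofAlgHom (comulHom 𝕜) (counitHom 𝕜)
    (algHom_ext fun n K => by
      simp only [AlgHom.comp_apply]
      rw [comulHom_basis]
      simp only [map_sum, Algebra.TensorProduct.map_tmul,
        comulHom_induce, TensorProduct.sum_tmul, TensorProduct.tmul_sum, AlgHom.id_apply,
        AlgEquiv.coe_toAlgHom, Algebra.TensorProduct.assoc_tmul]
      rw [Finset.sum_sigma', Finset.sum_sigma']
      refine Finset.sum_bij' (fun p _ => ⟨p.2, p.1 \ p.2⟩) (fun p _ => ⟨p.1 ∪ p.2, p.1⟩)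
        ?_ ?_ ?_ ?_ ?_
      · rintro ⟨T, U⟩ h
        simp only [Finset.mem_sigma, Finset.mem_univ, Finset.mem_powerset, true_and] at h ⊢
        intro x hx
        simp_all
      · rintro ⟨T, U⟩ h
        exact Finset.mem_sigma.mpr ⟨Finset.mem_univ _,
          Finset.mem_powerset.mpr Finset.subset_union_left⟩
      · rintro ⟨T, U⟩ h
        simp only [Finset.mem_sigma, Finset.mem_univ, Finset.mem_powerset, true_and] at h
        simp [Finset.union_sdiff_of_subset h]
      · rintro ⟨T, U⟩ h
        simp only [Finset.mem_sigma, Finset.mem_univ, Finset.mem_powerset, true_and] at h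
        have : Disjoint U T := Finset.subset_compl_iff_disjoint_right.mp h
        simp [Finset.union_sdiff_cancel_left this.symm]
      · rintro ⟨T, U⟩ h
        simp only [Finset.mem_sigma, Finset.mem_univ, Finset.mem_powerset, true_and] at h
        have : Uᶜ \ (T \ U) = Tᶜ := by
          ext x
          have := @h x
          simp
          tauto
        rw [this])
    (algHom_ext fun n K => by
      simp only [AlgHom.comp_apply, comulHom_basis, map_sum, Algebra.TensorProduct.map_tmul,
        counitHom_basis, AlgHom.id_apply]
      rw [Finset.sum_eq_single ∅ (fun T _ hT => by simp [hT]) (by simp)]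
      simp [basis_congr 𝕜 K Finset.compl_empty, basis_induce_univ])
    (algHom_ext fun n K => by
      simp only [AlgHom.comp_apply, comulHom_basis, map_sum, Algebra.TensorProduct.map_tmul,
        counitHom_basis, AlgHom.id_apply]
      rw [Finset.sum_eq_single Finset.univ (fun T _ hT => by
        rw [if_neg (by
          rw [Fintype.card_coe, Finset.card_eq_zero, Finset.compl_eq_empty_iff]
          exact hT),
          TensorProduct.tmul_zero]) (by simp)]
      simp [basis_induce_univ])

theorem degree_out (x : ComplexClass) : x.out.1 = x.degree := by
  conv_rhs => rw [← Quotient.out_eq x]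
  rfl

/-- The antipode on basis elements, by the usual recursion in a connected graded bialgebra:
`S(∅) = 1`, and `S([K]) = - ∑_{T ≠ V} S([K_T]) [K_{V - T}]` if `K` has vertices. -/
noncomputable def antipodeBasis (x : ComplexClass) : ComplexAlgebra 𝕜 :=
  if x.degree = 0 then 1 else
    - ∑ T : {T : Finset (Fin x.out.1) // T ≠ Finset.univ},
        antipodeBasis (ComplexClass.mk (x.out.2.induce T.1)) * basis 𝕜 (x.out.2.induce T.1ᶜ)
termination_by x.degree
decreasing_by
  rw [ComplexClass.degree_mk, Nat.card_eq_fintype_card, Fintype.card_coe, ← degree_out]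
  exact (Finset.card_lt_card (Finset.ssubset_univ_iff.mpr T.2)).trans_eq (by simp)

/-- The antipode. -/
noncomputable def antipodeLinear : ComplexAlgebra 𝕜 →ₗ[𝕜] ComplexAlgebra 𝕜 :=
  liftLinear 𝕜 (antipodeBasis 𝕜)

theorem sum_antipode_mul (x : ComplexClass) :
    ∑ T : Finset (Fin x.out.1),
      antipodeLinear 𝕜 (basis 𝕜 (x.out.2.induce T)) * basis 𝕜 (x.out.2.induce Tᶜ) =
      if x.out.1 = 0 then 1 else 0 := by
  have hx : ComplexClass.mk x.out.2 = x := (ComplexClass.mk_fin _).symm.trans (Quotient.out_eq x)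
  have hS : ∀ y, antipodeLinear 𝕜 (single 𝕜 y) = antipodeBasis 𝕜 y := liftLinear_single 𝕜 _
  rw [← Finset.add_sum_erase _ _ (Finset.mem_univ Finset.univ), Finset.compl_univ,
    basis_induce_empty, mul_one, basis_induce_univ]
  simp only [basis, hS]
  rw [hx]
  conv_lhs => enter [1]; rw [antipodeBasis]
  simp only [degree_out]
  split_ifs with h
  · rw [add_eq_left, Finset.sum_eq_zero]
    intro T hT
    have h0 : IsEmpty (Fin x.out.1) := by rw [degree_out, h]; infer_instance
    exact absurd (Subsingleton.elim T _) (Finset.ne_of_mem_erase hT)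
  · rw [neg_add_eq_zero]
    have hs : ∀ T : Finset (Fin x.out.1),
        T ∈ Finset.univ.erase Finset.univ ↔ T ≠ Finset.univ := by simp
    exact (Finset.sum_subtype _ hs fun T =>
      antipodeBasis 𝕜 (ComplexClass.mk (x.out.2.induce T)) *
        single 𝕜 (ComplexClass.mk (x.out.2.induce Tᶜ))).symm

theorem sum_antipode_mul_fin (n : ℕ) (K : AbstractSimplicialComplex (Fin n)) :
    LinearMap.mul' 𝕜 (ComplexAlgebra 𝕜)
      ((antipodeLinear 𝕜).rTensor (ComplexAlgebra 𝕜) (comulHom 𝕜 (basis 𝕜 K))) =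
      algebraMap 𝕜 (ComplexAlgebra 𝕜) (counitHom 𝕜 (basis 𝕜 K)) := by
  have hx : ComplexClass.mk (ComplexClass.mk K).out.2 = ComplexClass.mk K :=
    (ComplexClass.mk_fin _).symm.trans (Quotient.out_eq _)
  have hb : basis 𝕜 K = basis 𝕜 (ComplexClass.mk K).out.2 := congrArg (single 𝕜) hx.symm
  rw [hb, comulHom_basis, counitHom_basis]
  simp only [map_sum, LinearMap.rTensor_tmul, LinearMap.mul'_apply, Fintype.card_fin]
  rw [sum_antipode_mul]
  split_ifs <;> simp

noncomputable instance : HopfAlgebra 𝕜 (ComplexAlgebra 𝕜) where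
  antipode := antipodeLinear 𝕜
  mul_antipode_rTensor_comul := linearMap_ext fun n K => sum_antipode_mul_fin 𝕜 n K
  mul_antipode_lTensor_comul := linearMap_ext fun n K => by
    refine Eq.trans ?_ (sum_antipode_mul_fin 𝕜 n K)
    change LinearMap.mul' 𝕜 (ComplexAlgebra 𝕜)
      ((antipodeLinear 𝕜).lTensor (ComplexAlgebra 𝕜) (comulHom 𝕜 (basis 𝕜 K))) = _
    rw [comulHom_basis]
    simp only [map_sum, LinearMap.rTensor_tmul, LinearMap.lTensor_tmul, LinearMap.mul'_apply]
    refine Fintype.sum_equiv (Function.Involutive.toPerm _ compl_involutive) _ _ fun T => ?_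
    have h : basis 𝕜 (K.induce Tᶜᶜ) = basis 𝕜 (K.induce T) :=
      basis_congr 𝕜 K (compl_compl T)
    simp [mul_comm, h]

end ComplexAlgebra

/-!
Both sides extend to functions `f` of a finite set `U` of vertices, by restricting to the subcomplex
or subgraph induced on `U`. Each of them satisfies `∑_{S ⊆ U} f(S) = [U = ∅]`, and the only solution
of these equations is `f(U) = (-1)^|U|`.

For the antipode, apply the character `[K] ↦ 1` to the identity that makes the antipode a left
convolution inverse of `id`: the character is the sum of coefficients, and turns `id` into `1`.

For the flats, a pair of a flat `F` of `G` and an acyclic orientation of `G / F` is the same as a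
weak orientation of `G`: edges may be directed both ways, and every arc on a directed cycle is
two-way; the two-way arcs form `F`. A weak orientation of `G[S]` extends to `G[U]` by directing the
edges between `S` and `U - S` out of `S` and making the edges inside `U - S` two-way. Its two-way
components inside `S` are unchanged, and the weak orientations of `G[U]` arising in this way are
those for which `U - S` is terminal: no arc leaves it and all arcs inside it are two-way. So
`∑_{S ⊆ U} f(S)` becomes, for each weak orientation of `G[U]`, a sum of signs over the sets `S` with
terminal complement. If `U ≠ ∅` there is a terminal two-way component `C`, and `S ↦ S ∆ C` is a
sign-reversing involution.
-/

theorem eq_of_forall_sum_powerset_eq {α M : Type*} [AddCommMonoid M] [IsRightCancelAdd M]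
    {f g : Finset α → M}
    (h : ∀ U : Finset α, ∑ S ∈ U.powerset, f S = ∑ S ∈ U.powerset, g S) : f = g := by
  classical
  funext U
  induction U using Finset.strongInduction with
  | H U ih =>
    have hU := h U
    rw [← Finset.insert_erase (Finset.mem_powerset_self U),
      Finset.sum_insert (Finset.notMem_erase _ _), Finset.sum_insert (Finset.notMem_erase _ _),
      ← Finset.ssubsets, Finset.sum_congr rfl fun S hS => ih S (Finset.mem_ssubsets.mp hS)] at hU
    exact add_right_cancel hU

theorem eq_neg_one_pow_card_of_sum_powerset_eq {α R : Type*} [DecidableEq α] [Ring R]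
    {f : Finset α → R} (h : ∀ U : Finset α, ∑ S ∈ U.powerset, f S = if U = ∅ then 1 else 0)
    (U : Finset α) : f U = (-1) ^ U.card := by
  refine congrFun (eq_of_forall_sum_powerset_eq (g := fun S => (-1) ^ S.card)
    fun U => (h U).trans ?_) U
  have hsum := congrArg (Int.cast : ℤ → R) (Finset.sum_powerset_neg_one_pow_card (x := U))
  push_cast at hsum
  exact hsum.symm

/-! ### The antipode -/

namespace ComplexAlgebra

variable (𝕜 : Type*) [Field 𝕜]

theorem coeffSum_eq_liftAlg_one (x : ComplexAlgebra 𝕜) :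
    coeffSum 𝕜 x = liftAlg 𝕜 (1 : ComplexClass →* 𝕜) x := by
  refine Eq.trans ?_ (MonoidAlgebra.lift_apply (1 : ComplexClass →* 𝕜) x).symm
  simp [coeffSum, coeffs]

theorem liftAlg_one_basis {V : Type*} [Finite V] (K : AbstractSimplicialComplex V) :
    liftAlg 𝕜 (1 : ComplexClass →* 𝕜) (basis 𝕜 K) = 1 :=
  liftAlg_single 𝕜 _ _

theorem sum_powerset_antipode_induce_mul {V : Type*} [DecidableEq V]
    (K : AbstractSimplicialComplex V) (T : Finset V) :
    ∑ S ∈ T.powerset,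
        HopfAlgebra.antipode 𝕜 (basis 𝕜 (K.induce S)) * basis 𝕜 (K.induce (T \ S)) =
      algebraMap 𝕜 (ComplexAlgebra 𝕜) (if T = ∅ then 1 else 0) := by
  have h := HopfAlgebra.mul_antipode_rTensor_comul_apply (R := 𝕜) (basis 𝕜 (K.induce T))
  change LinearMap.mul' 𝕜 _ ((HopfAlgebra.antipode 𝕜).rTensor _ (comulHom 𝕜 _)) =
    algebraMap 𝕜 _ (counitHom 𝕜 _) at h
  simpa only [comulHom_induce, counitHom_basis, Fintype.card_coe, Finset.card_eq_zero, map_sum,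
    LinearMap.rTensor_tmul, LinearMap.mul'_apply] using h

theorem sum_powerset_coeffSum_antipode_induce {V : Type*} [DecidableEq V]
    (K : AbstractSimplicialComplex V) (T : Finset V) :
    ∑ S ∈ T.powerset, coeffSum 𝕜 (HopfAlgebra.antipode 𝕜 (basis 𝕜 (K.induce S))) =
      if T = ∅ then 1 else 0 := by
  have h := congrArg (liftAlg 𝕜 (1 : ComplexClass →* 𝕜))
    (sum_powerset_antipode_induce_mul 𝕜 K T)
  simpa only [coeffSum_eq_liftAlg_one, map_sum, map_mul, liftAlg_one_basis, mul_one,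
    AlgHom.commutes, Algebra.algebraMap_self, RingHom.id_apply] using h

theorem coeffSum_antipode_basis {V : Type*} [Fintype V] (K : AbstractSimplicialComplex V) :
    coeffSum 𝕜 (HopfAlgebra.antipode 𝕜 (basis 𝕜 K)) = (-1) ^ Fintype.card V := by
  classical
  rw [← basis_induce_univ, ← Finset.card_univ]
  exact eq_neg_one_pow_card_of_sum_powerset_eq (sum_powerset_coeffSum_antipode_induce 𝕜 K) _

end ComplexAlgebra

/-! ### Weak orientations -/

section WeakOrientations

open SimpleGraph Relation
open scoped symmDiff

variable {V : Type*} {G H : SimpleGraph V} {D : V → V → Prop} {S T : Set V}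

theorem mem_of_reflTransGen_of_closed (hT : ∀ ⦃v w⦄, D v w → v ∈ T → w ∈ T) {v w : V}
    (h : ReflTransGen D v w) (hv : v ∈ T) : w ∈ T := by
  induction h with
  | refl => exact hv
  | tail _ h ih => exact hT h ih

/-- The graph of the two-way arcs of a relation. -/
def tieGraph (D : V → V → Prop) : SimpleGraph V where
  Adj v w := v ≠ w ∧ D v w ∧ D w v
  symm := ⟨fun _ _ h => ⟨h.1.symm, h.2.2, h.2.1⟩⟩
  loopless := ⟨fun _ h => h.1 rfl⟩

theorem reflTransGen_of_reachable_tieGraph {v w : V} (h : (tieGraph D).Reachable v w) :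
    ReflTransGen D v w :=
  ReflTransGen.mono (fun _ _ h => h.2.1) _ _ ((reachable_iff_reflTransGen v w).mp h)

/-- A relation is weakly acyclic if every arc lying on a directed cycle is a two-way arc. -/
def IsWeaklyAcyclic (D : V → V → Prop) : Prop :=
  ∀ ⦃v w⦄, D v w → ReflTransGen D w v → D w v

/-- A set of vertices is terminal for a relation if no arc leaves it and every arc starting in it
is a two-way arc. -/
def IsTerminal (D : V → V → Prop) (T : Set V) : Prop :=
  ∀ ⦃v w⦄, D v w → v ∈ T → w ∈ T ∧ D w v

theorem IsTerminal.mem_of_reflTransGen (hT : IsTerminal D T) {v w : V}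
    (h : ReflTransGen D v w) (hv : v ∈ T) : w ∈ T :=
  mem_of_reflTransGen_of_closed (fun _ _ h hv => (hT h hv).1) h hv

theorem IsTerminal.compl_symmDiff (hS : IsTerminal D Sᶜ) (hT : IsTerminal D T) :
    IsTerminal D (S ∆ T)ᶜ := by
  intro v w h hv
  have hvw : v ∈ T → w ∈ T ∧ D w v := hT h
  have hwv : D w v → w ∈ T → v ∈ T := fun h hw => (hT h hw).1
  have hvw' : v ∉ S → w ∉ S ∧ D w v := hS h
  have hwv' : D w v → w ∉ S → v ∉ S := fun h hw => (hS h hw).1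
  simp only [Set.mem_compl_iff, Set.mem_symmDiff] at hv ⊢
  tauto

theorem IsTerminal.supp_subset_or_disjoint (hT : IsTerminal D T)
    (c : (tieGraph D).ConnectedComponent) : c.supp ⊆ T ∨ Disjoint c.supp T := by
  refine or_iff_not_imp_right.mpr fun h v hv => ?_
  obtain ⟨w, hw, hwT⟩ := Set.not_disjoint_iff.mp h
  exact hT.mem_of_reflTransGen
    (reflTransGen_of_reachable_tieGraph (c.reachable_of_mem_supp hw hv)) hwT

theorem IsWeaklyAcyclic.exists_isTerminal_supp [Finite V] (hD : IsWeaklyAcyclic D) (v : V) :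
    ∃ w, ReflTransGen D v w ∧ IsTerminal D ((tieGraph D).connectedComponentMk w).supp := by
  let : Preorder V :=
    { le := ReflTransGen D
      le_refl := fun _ => .refl
      le_trans := fun _ _ _ => ReflTransGen.trans }
  obtain ⟨w, hvw, hw⟩ := Finite.exists_le_maximal (p := fun _ : V => True) (a := v) trivial
  have hback : ∀ x, ReflTransGen D w x → ReflTransGen D x w := fun x hx => hw.2 trivial hx
  refine ⟨w, hvw, fun x y hxy hx => ?_⟩
  have hwx : ReflTransGen D w x :=
    reflTransGen_of_reachable_tieGraph (ConnectedComponent.exact hx).symm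
  have hyx : D y x := hD hxy ((hback y (hwx.tail hxy)).trans hwx)
  refine ⟨?_, hyx⟩
  rcases eq_or_ne x y with rfl | hne
  · exact hx
  · have htie : (tieGraph D).Adj y x := ⟨hne.symm, hyx, hxy⟩
    exact (ConnectedComponent.sound htie.reachable).trans hx

/-- The number of connected components of a graph that meet a given set of vertices. -/
noncomputable def numComponentsMeeting (H : SimpleGraph V) (S : Set V) : ℕ :=
  (H.connectedComponentMk '' S).ncard

theorem numComponentsMeeting_empty (H : SimpleGraph V) : numComponentsMeeting H ∅ = 0 := by
  simp [numComponentsMeeting]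

theorem numComponentsMeeting_univ (H : SimpleGraph V) :
    numComponentsMeeting H Set.univ = Nat.card H.ConnectedComponent := by
  rw [numComponentsMeeting,
    Set.image_univ_of_surjective (f := H.connectedComponentMk) Quot.mk_surjective, Set.ncard_univ]

theorem numComponentsMeeting_union_supp [Finite V] {c : H.ConnectedComponent}
    (h : Disjoint c.supp S) :
    numComponentsMeeting H (S ∪ c.supp) = numComponentsMeeting H S + 1 := by
  have himage : H.connectedComponentMk '' c.supp = {c} :=
    Set.eq_singleton_iff_nonempty_unique_mem.mpr
      ⟨c.nonempty_supp.image _, Set.forall_mem_image.mpr fun _ hv => hv⟩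
  have hc : c ∉ H.connectedComponentMk '' S := by
    rintro ⟨v, hv, rfl⟩
    exact Set.disjoint_left.mp h rfl hv
  rw [numComponentsMeeting, Set.image_union, himage, Set.union_singleton,
    Set.ncard_insert_of_notMem hc, numComponentsMeeting]

theorem neg_one_pow_numComponentsMeeting_symmDiff_supp [Finite V] {c : H.ConnectedComponent}
    (h : c.supp ⊆ S ∨ Disjoint c.supp S) :
    (-1 : ℤ) ^ numComponentsMeeting H (S ∆ c.supp) = -(-1) ^ numComponentsMeeting H S := by
  rcases h with h | h
  · have hS : numComponentsMeeting H S = numComponentsMeeting H (S \ c.supp) + 1 := by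
      rw [← numComponentsMeeting_union_supp Set.disjoint_sdiff_right, Set.sdiff_union_of_subset h]
    rw [symmDiff_of_ge h, hS, pow_succ, mul_neg_one, neg_neg]
  · have hS : S ∆ c.supp = S ∪ c.supp := h.symm.symmDiff_eq_sup
    rw [hS, numComponentsMeeting_union_supp h, pow_succ, mul_neg_one]

protected theorem IsTerminal.neg_one_pow_numComponentsMeeting_symmDiff_supp [Finite V]
    (hS : IsTerminal D Sᶜ) (c : (tieGraph D).ConnectedComponent) :
    (-1 : ℤ) ^ numComponentsMeeting (tieGraph D) (S ∆ c.supp) =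
      -(-1) ^ numComponentsMeeting (tieGraph D) S :=
  neg_one_pow_numComponentsMeeting_symmDiff_supp
    ((hS.supp_subset_or_disjoint c).symm.imp Set.disjoint_compl_right_iff_subset.mp
      Set.subset_compl_iff_disjoint_right.mp)

open Classical in
theorem IsWeaklyAcyclic.sum_isTerminal_compl_eq_zero [Finite V] (hD : IsWeaklyAcyclic D)
    {U : Finset V} (hU : U.Nonempty) (hDU : ∀ ⦃v w⦄, D v w → w ∈ U) :
    ∑ S ∈ U.powerset.filter fun S : Finset V => IsTerminal D (S : Set V)ᶜ,
      (-1 : ℤ) ^ numComponentsMeeting (tieGraph D) S = 0 := by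
  have := Fintype.ofFinite V
  obtain ⟨v, hv⟩ := hU
  obtain ⟨w, hvw, hw⟩ := hD.exists_isTerminal_supp v
  set c := (tieGraph D).connectedComponentMk w
  have hcU : c.supp.toFinset ⊆ U := fun x hx =>
    mem_of_reflTransGen_of_closed (T := (U : Set V)) (fun _ _ h _ => hDU h)
      (hvw.trans (reflTransGen_of_reachable_tieGraph
        (c.reachable_of_mem_supp rfl (Set.mem_toFinset.mp hx)))) hv
  -- Toggling the terminal component `c` changes the number of components by one.
  refine Finset.sum_involution (fun S _ => S ∆ c.supp.toFinset) ?_ ?_ ?_ ?_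
  · intro S hS
    rw [Finset.coe_symmDiff, Set.coe_toFinset,
      (Finset.mem_filter.mp hS).2.neg_one_pow_numComponentsMeeting_symmDiff_supp, add_neg_cancel]
  · intro S _ _ h
    exact (Set.toFinset_nonempty.mpr c.nonempty_supp).ne_empty (symmDiff_eq_left.mp h)
  · intro S hS
    rw [Finset.mem_filter, Finset.mem_powerset] at hS ⊢
    refine ⟨Finset.symmDiff_subset_union.trans (Finset.union_subset hS.1 hcU), ?_⟩
    rw [Finset.coe_symmDiff, Set.coe_toFinset]
    exact hS.2.compl_symmDiff hw
  · intro S _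
    exact symmDiff_symmDiff_cancel_right _ _

theorem spanningCoe_induce_adj {v w : V} :
    (H.induce S).spanningCoe.Adj v w ↔ H.Adj v w ∧ v ∈ S ∧ w ∈ S := by
  simp

theorem spanningCoe_induce_spanningCoe_induce (G : SimpleGraph V) {S U : Set V} (h : S ⊆ U) :
    ((G.induce U).spanningCoe.induce S).spanningCoe = (G.induce S).spanningCoe := by
  ext v w
  simp only [spanningCoe_induce_adj]
  exact ⟨fun hvw => ⟨hvw.1.1, hvw.2⟩, fun hvw => ⟨⟨hvw.1, h hvw.2.1, h hvw.2.2⟩, hvw.2⟩⟩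

theorem numComponentsMeeting_spanningCoe_induce (hS : ∀ ⦃v w⦄, H.Adj v w → v ∈ S → w ∈ S) :
    numComponentsMeeting (H.induce S).spanningCoe S = numComponentsMeeting H S := by
  have hreach : ∀ ⦃v⦄, v ∈ S → ∀ ⦃w⦄, H.Reachable v w → (H.induce S).spanningCoe.Reachable v w := by
    intro v hv w h
    rw [reachable_iff_reflTransGen] at h
    induction h with
    | refl => rfl
    | tail hvb hbc ih =>
      have hb := mem_of_reflTransGen_of_closed hS hvb hv
      exact ih.trans (spanningCoe_induce_adj.mpr ⟨hbc, hb, hS hbc hb⟩).reachable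
  have hle : (H.induce S).spanningCoe ≤ H := spanningCoe_induce_le H S
  rw [numComponentsMeeting, numComponentsMeeting,
    ← Set.InjOn.ncard_image (f := ConnectedComponent.map (Hom.ofLE hle)), Set.image_image]
  · rfl
  · rintro _ ⟨v, hv, rfl⟩ _ ⟨w, -, rfl⟩ h
    exact ConnectedComponent.sound (hreach hv (ConnectedComponent.exact h))

/-- A weak orientation of a graph chooses at least one direction of every edge, has no other arcs,
and is weakly acyclic. -/
structure IsWeakOrientation (H : SimpleGraph V) (D : V → V → Prop) : Prop where
  adj_iff : ∀ v w, H.Adj v w ↔ D v w ∨ D w v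
  isWeaklyAcyclic : IsWeaklyAcyclic D

theorem IsWeakOrientation.adj (hD : IsWeakOrientation H D) {v w : V} (h : D v w) : H.Adj v w :=
  (hD.adj_iff v w).mpr (Or.inl h)

theorem isWeakOrientation_bot_iff : IsWeakOrientation ⊥ D ↔ D = fun _ _ => False := by
  constructor
  · intro hD
    ext v w
    exact iff_false_intro fun h => hD.adj h
  · rintro rfl
    exact ⟨by simp, fun _ _ => False.elim⟩

/-- The restriction of a relation to a set of vertices. -/
def restrictRel (D : V → V → Prop) (S : Set V) (v w : V) : Prop := D v w ∧ v ∈ S ∧ w ∈ S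

theorem tieGraph_restrictRel (D : V → V → Prop) (S : Set V) :
    tieGraph (restrictRel D S) = ((tieGraph D).induce S).spanningCoe := by
  ext v w
  simp only [tieGraph, restrictRel, spanningCoe_induce_adj]
  tauto

theorem IsTerminal.numComponentsMeeting_tieGraph_restrictRel (hS : IsTerminal D Sᶜ) :
    numComponentsMeeting (tieGraph (restrictRel D S)) S = numComponentsMeeting (tieGraph D) S := by
  rw [tieGraph_restrictRel]
  exact numComponentsMeeting_spanningCoe_induce fun v w h hv =>
    not_imp_not.mp (fun hw => (hS h.2.2 hw).1) hv

/-- The relation obtained by adding to `D` all edges of `H` that end outside `S`, directed towards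
that end. -/
def extendRel (H : SimpleGraph V) (D : V → V → Prop) (S : Set V) (v w : V) : Prop :=
  D v w ∨ H.Adj v w ∧ w ∉ S

theorem reflTransGen_of_reflTransGen_extendRel (hD : ∀ ⦃v w⦄, D v w → v ∈ S) {v w : V}
    (h : ReflTransGen (extendRel H D S) v w) (hw : w ∈ S) : ReflTransGen D v w := by
  induction h with
  | refl => exact .refl
  | tail _ h ih =>
    rcases h with h | h
    · exact (ih (hD h)).tail h
    · exact absurd hw h.2

namespace IsWeakOrientation

theorem mem_and_mem (hD : IsWeakOrientation (H.induce S).spanningCoe D) {v w : V} (h : D v w) :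
    v ∈ S ∧ w ∈ S :=
  (spanningCoe_induce_adj.mp (hD.adj h)).2

protected theorem restrictRel (hD : IsWeakOrientation H D) (S : Set V) :
    IsWeakOrientation (H.induce S).spanningCoe (restrictRel D S) where
  adj_iff v w := by
    simp only [spanningCoe_induce_adj, hD.adj_iff, restrictRel]
    tauto
  isWeaklyAcyclic _ _ h hback :=
    ⟨hD.isWeaklyAcyclic h.1 (ReflTransGen.mono (fun _ _ h => h.1) _ _ hback), h.2.2, h.2.1⟩

theorem isTerminal_extendRel (hD : IsWeakOrientation (H.induce S).spanningCoe D) :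
    IsTerminal (extendRel H D S) Sᶜ := by
  rintro v w (h | ⟨h, hw⟩) hv
  · exact absurd (hD.mem_and_mem h).1 hv
  · exact ⟨hw, Or.inr ⟨h.symm, hv⟩⟩

protected theorem extendRel (hD : IsWeakOrientation (H.induce S).spanningCoe D) :
    IsWeakOrientation H (extendRel H D S) where
  adj_iff v w := by
    have h := hD.adj_iff v w
    rw [spanningCoe_induce_adj] at h
    simp only [extendRel, H.adj_comm w v]
    tauto
  isWeaklyAcyclic v w h hback := by
    rcases h with h | ⟨h, hw⟩
    · exact Or.inl (hD.isWeaklyAcyclic h (reflTransGen_of_reflTransGen_extendRel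
        (fun _ _ h => (hD.mem_and_mem h).1) hback (hD.mem_and_mem h).1))
    · exact Or.inr ⟨h.symm, hD.isTerminal_extendRel.mem_of_reflTransGen hback hw⟩

theorem extendRel_restrictRel (hD : IsWeakOrientation H D) (hS : IsTerminal D Sᶜ) :
    extendRel H (restrictRel D S) S = D := by
  ext v w
  constructor
  · rintro (h | ⟨h, hw⟩)
    · exact h.1
    · exact ((hD.adj_iff v w).mp h).elim id fun h => (hS h hw).2
  · intro h
    by_cases hw : w ∈ S
    · exact Or.inl ⟨h, not_imp_not.mp (fun hv => (hS h hv).1) hw, hw⟩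
    · exact Or.inr ⟨hD.adj h, hw⟩

theorem restrictRel_extendRel (hD : IsWeakOrientation (H.induce S).spanningCoe D) :
    restrictRel (extendRel H D S) S = D := by
  ext v w
  constructor
  · rintro ⟨h | h, -, hw⟩
    · exact h
    · exact absurd hw h.2
  · exact fun h => ⟨Or.inl h, hD.mem_and_mem h⟩

end IsWeakOrientation

section Finite

variable [Fintype V]

open Classical in
/-- The number of weak orientations of the subgraph induced on a finite set `S` of vertices, each
counted with the sign given by its number of two-way components inside `S`. -/
noncomputable def weakOrientationSum (H : SimpleGraph V) (S : Finset V) : ℤ :=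
  ∑ D with IsWeakOrientation (H.induce (S : Set V)).spanningCoe D,
    (-1) ^ numComponentsMeeting (tieGraph D) S

open Classical in
theorem weakOrientationSum_eq_sum_isTerminal (H : SimpleGraph V) (S : Finset V) :
    weakOrientationSum H S = ∑ D with IsWeakOrientation H D ∧ IsTerminal D (S : Set V)ᶜ,
      (-1) ^ numComponentsMeeting (tieGraph D) S := by
  refine Finset.sum_bij' (fun D _ => extendRel H D S) (fun D _ => restrictRel D S) ?_ ?_ ?_ ?_ ?_
  all_goals
    intro D hD
    simp only [Finset.mem_filter, Finset.mem_univ, true_and] at hD ⊢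
  · exact ⟨hD.extendRel, hD.isTerminal_extendRel⟩
  · exact hD.1.restrictRel S
  · exact hD.restrictRel_extendRel
  · exact hD.1.extendRel_restrictRel hD.2
  · rw [← hD.isTerminal_extendRel.numComponentsMeeting_tieGraph_restrictRel,
      hD.restrictRel_extendRel]

theorem weakOrientationSum_empty (H : SimpleGraph V) : weakOrientationSum H ∅ = 1 := by
  classical
  have hbot : (H.induce ((∅ : Finset V) : Set V)).spanningCoe = ⊥ := by
    ext
    simp
  simp only [weakOrientationSum, hbot, isWeakOrientation_bot_iff, Finset.coe_empty,
    numComponentsMeeting_empty, pow_zero, Finset.sum_const, Finset.filter_eq', Finset.mem_univ,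
    if_true, Finset.card_singleton, one_smul]

theorem weakOrientationSum_spanningCoe_induce (G : SimpleGraph V) {S U : Finset V} (h : S ⊆ U) :
    weakOrientationSum (G.induce (U : Set V)).spanningCoe S = weakOrientationSum G S := by
  rw [weakOrientationSum, spanningCoe_induce_spanningCoe_induce G (Finset.coe_subset.mpr h),
    weakOrientationSum]

theorem sum_powerset_weakOrientationSum [DecidableEq V] (G : SimpleGraph V) (U : Finset V) :
    ∑ S ∈ U.powerset, weakOrientationSum G S = if U = ∅ then 1 else 0 := by
  classical
  rcases U.eq_empty_or_nonempty with rfl | hU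
  · simp [weakOrientationSum_empty]
  rw [if_neg hU.ne_empty]
  calc ∑ S ∈ U.powerset, weakOrientationSum G S
      = ∑ S ∈ U.powerset, ∑ D with IsWeakOrientation (G.induce (U : Set V)).spanningCoe D ∧
          IsTerminal D (S : Set V)ᶜ, (-1) ^ numComponentsMeeting (tieGraph D) S :=
        Finset.sum_congr rfl fun S hS => by
          rw [← weakOrientationSum_spanningCoe_induce G (Finset.mem_powerset.mp hS),
            weakOrientationSum_eq_sum_isTerminal]
          congr!
    _ = ∑ D with IsWeakOrientation (G.induce (U : Set V)).spanningCoe D,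
          ∑ S ∈ U.powerset.filter fun S : Finset V => IsTerminal D (S : Set V)ᶜ,
            (-1) ^ numComponentsMeeting (tieGraph D) S :=
        Finset.sum_comm' fun S D => by simp; tauto
    _ = 0 := Finset.sum_eq_zero fun D hD =>
        have hD := (Finset.mem_filter.mp hD).2
        hD.isWeaklyAcyclic.sum_isTerminal_compl_eq_zero hU fun _ _ h => (hD.mem_and_mem h).2

theorem weakOrientationSum_eq (G : SimpleGraph V) (U : Finset V) :
    weakOrientationSum G U = (-1) ^ U.card := by
  classical
  exact eq_neg_one_pow_card_of_sum_powerset_eq (sum_powerset_weakOrientationSum G) U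

end Finite

/-! ### Flats and weak orientations -/

theorem mk_eq_mk_of_mem {F : Set (Sym2 V)} {v w : V} (h : s(v, w) ∈ F) :
    (fromEdgeSet F).connectedComponentMk v = (fromEdgeSet F).connectedComponentMk w := by
  rcases eq_or_ne v w with rfl | hne
  · rfl
  · exact ConnectedComponent.sound (Adj.reachable ((fromEdgeSet_adj F).mpr ⟨h, hne⟩))

theorem isFlat_iff_forall_adj {F : Set (Sym2 V)} :
    G.IsFlat F ↔ F ⊆ G.edgeSet ∧
      ∀ ⦃v w⦄, (fromEdgeSet F).Reachable v w → G.Adj v w → s(v, w) ∈ F := by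
  refine and_congr_right fun hF => ⟨fun h v w hr hvw => ?_, fun h c => ?_⟩
  · have hadj := congrArg (fun H => H.Adj ⟨v, rfl⟩ ⟨w, ConnectedComponent.sound hr.symm⟩)
      (h ((fromEdgeSet F).connectedComponentMk v))
    simp only [comap_adj, Function.Embedding.subtype_apply, fromEdgeSet_adj] at hadj
    exact (hadj.mpr hvw).1
  · ext ⟨v, hv⟩ ⟨w, hw⟩
    simp only [comap_adj, Function.Embedding.subtype_apply, fromEdgeSet_adj]
    exact ⟨fun h => hF h.1, fun hvw => ⟨h (c.reachable_of_mem_supp hv hw) hvw, hvw.ne⟩⟩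

theorem numComponents_edgeSet (H : SimpleGraph V) :
    numComponents H.edgeSet = numComponentsMeeting H Set.univ := by
  rw [numComponents, fromEdgeSet_edgeSet, numComponentsMeeting_univ]

/-- The relation on the vertices of `G` whose arcs are the edges in `F`, in both directions, and
the edges between different components of `F`, directed as in the digraph `O` on `G / F`. -/
def liftRel (G : SimpleGraph V) (F : Set (Sym2 V))
    (O : Digraph (fromEdgeSet F).ConnectedComponent) (v w : V) : Prop :=
  s(v, w) ∈ F ∨ G.Adj v w ∧
    O.Adj ((fromEdgeSet F).connectedComponentMk v) ((fromEdgeSet F).connectedComponentMk w)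

/-- The digraph induced by a relation on the components of the graph with edge set `F`, that is,
on the vertices of `G / F`. -/
def quotientDigraph (F : Set (Sym2 V)) (D : V → V → Prop) :
    Digraph (fromEdgeSet F).ConnectedComponent where
  Adj c d := c ≠ d ∧ ∃ v w, v ∈ c.supp ∧ w ∈ d.supp ∧ D v w

section Lift

variable {F : Set (Sym2 V)} {O : Digraph (fromEdgeSet F).ConnectedComponent}

theorem reflTransGen_mk_of_liftRel {v w : V} (h : ReflTransGen (liftRel G F O) v w) :
    ReflTransGen O.Adj
      ((fromEdgeSet F).connectedComponentMk v) ((fromEdgeSet F).connectedComponentMk w) := by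
  induction h with
  | refl => exact .refl
  | tail _ h ih =>
    rcases h with h | h
    · rwa [← mk_eq_mk_of_mem h]
    · exact ih.tail h.2

theorem isWeaklyAcyclic_liftRel (hO : ∀ c, ¬ TransGen O.Adj c c) :
    IsWeaklyAcyclic (liftRel G F O) := by
  rintro v w (h | h) hback
  · exact Or.inl (Sym2.eq_swap ▸ h)
  · exact absurd (TransGen.head' h.2 (reflTransGen_mk_of_liftRel hback)) (hO _)

theorem isWeakOrientation_liftRel (hF : G.IsFlat F) (hO : (G.contract F).IsOrientation O)
    (hc : ∀ c, ¬ TransGen O.Adj c c) : IsWeakOrientation G (liftRel G F O) where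
  isWeaklyAcyclic := isWeaklyAcyclic_liftRel hc
  adj_iff v w := by
    refine ⟨fun h => ?_, ?_⟩
    · by_cases hvw :
        (fromEdgeSet F).connectedComponentMk v = (fromEdgeSet F).connectedComponentMk w
      · exact Or.inl (Or.inl ((isFlat_iff_forall_adj.mp hF).2 (ConnectedComponent.exact hvw) h))
      · exact ((hO.1 _ _).mp ⟨hvw, v, w, rfl, rfl, h⟩).imp (fun h' => Or.inr ⟨h, h'⟩)
          (fun h' => Or.inr ⟨h.symm, h'⟩)
    · rintro ((h | h) | (h | h))
      · exact hF.1 h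
      · exact h.1
      · exact G.adj_symm (hF.1 h)
      · exact h.1.symm

theorem edgeSet_tieGraph_liftRel (hF : F ⊆ G.edgeSet) (hO : (G.contract F).IsOrientation O) :
    (tieGraph (liftRel G F O)).edgeSet = F := by
  ext e
  induction e with | h v w
  constructor
  · rintro ⟨-, h | h, h' | h'⟩
    · exact h
    · exact h
    · exact Sym2.eq_swap ▸ h'
    · exact absurd h'.2 (hO.2 _ _ h.2)
  · exact fun h => ⟨G.ne_of_adj (hF h), Or.inl h, Or.inl (Sym2.eq_swap ▸ h)⟩

theorem quotientDigraph_liftRel (hO : (G.contract F).IsOrientation O) :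
    quotientDigraph F (liftRel G F O) = O := by
  ext c d
  constructor
  · rintro ⟨hcd, v, w, rfl, rfl, h | h⟩
    · exact absurd (mk_eq_mk_of_mem h) hcd
    · exact h.2
  · intro h
    obtain ⟨hcd, v, w, rfl, rfl, hvw⟩ := (hO.1 c d).mpr (Or.inl h)
    exact ⟨hcd, v, w, rfl, rfl, Or.inr ⟨hvw, h⟩⟩

end Lift

theorem reflTransGen_of_quotientDigraph_edgeSet_tieGraph {v w : V}
    (h : ReflTransGen (quotientDigraph (tieGraph D).edgeSet D).Adj
      (connectedComponentMk _ v) (connectedComponentMk _ w)) : ReflTransGen D v w := by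
  have hmk {x y : V} (hxy : (fromEdgeSet (tieGraph D).edgeSet).connectedComponentMk x =
      (fromEdgeSet (tieGraph D).edgeSet).connectedComponentMk y) : ReflTransGen D x y := by
    have := ConnectedComponent.exact hxy
    rw [fromEdgeSet_edgeSet] at this
    exact reflTransGen_of_reachable_tieGraph this
  generalize hd : (fromEdgeSet (tieGraph D).edgeSet).connectedComponentMk w = d at h
  induction h generalizing w with
  | refl => exact hmk hd.symm
  | tail _ h ih =>
    obtain ⟨-, x, y, hx, hy, hxy⟩ := h
    exact ((ih hx).tail hxy).trans (hmk (hy.trans hd.symm))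

namespace IsWeakOrientation

theorem isFlat_edgeSet_tieGraph (hD : IsWeakOrientation G D) : G.IsFlat (tieGraph D).edgeSet := by
  refine isFlat_iff_forall_adj.mpr ⟨edgeSet_mono fun v w h => hD.adj h.2.1, fun v w hr hvw => ?_⟩
  rw [fromEdgeSet_edgeSet] at hr
  rcases (hD.adj_iff v w).mp hvw with h | h
  · exact ⟨hvw.ne, h, hD.isWeaklyAcyclic h (reflTransGen_of_reachable_tieGraph hr.symm)⟩
  · exact ⟨hvw.ne, hD.isWeaklyAcyclic h (reflTransGen_of_reachable_tieGraph hr), h⟩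

theorem not_transGen_quotientDigraph (hD : IsWeakOrientation G D)
    (c : (fromEdgeSet (tieGraph D).edgeSet).ConnectedComponent) :
    ¬ TransGen (quotientDigraph (tieGraph D).edgeSet D).Adj c c := by
  intro h
  obtain ⟨d, ⟨hcd, v, w, rfl, rfl, hvw⟩, h⟩ := TransGen.head'_iff.mp h
  have hwv := hD.isWeaklyAcyclic hvw (reflTransGen_of_quotientDigraph_edgeSet_tieGraph h)
  exact hcd (mk_eq_mk_of_mem ⟨(hD.adj hvw).ne, hvw, hwv⟩)

theorem isOrientation_quotientDigraph (hD : IsWeakOrientation G D) :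
    (G.contract (tieGraph D).edgeSet).IsOrientation (quotientDigraph (tieGraph D).edgeSet D) := by
  refine ⟨fun c d => ⟨?_, ?_⟩, fun c d h h' =>
    hD.not_transGen_quotientDigraph c (.tail (.single h) h')⟩
  · rintro ⟨hcd, v, w, hv, hw, h⟩
    exact ((hD.adj_iff v w).mp h).imp
      (fun h => ⟨hcd, v, w, hv, hw, h⟩) (fun h => ⟨hcd.symm, w, v, hw, hv, h⟩)
  · rintro (⟨hcd, v, w, hv, hw, h⟩ | ⟨hcd, v, w, hv, hw, h⟩)
    · exact ⟨hcd, v, w, hv, hw, hD.adj h⟩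
    · exact ⟨hcd.symm, w, v, hw, hv, (hD.adj h).symm⟩

theorem liftRel_quotientDigraph (hD : IsWeakOrientation G D) :
    liftRel G (tieGraph D).edgeSet (quotientDigraph (tieGraph D).edgeSet D) = D := by
  ext v w
  constructor
  · rintro (h | ⟨hvw, h⟩)
    · exact h.2.1
    · refine ((hD.adj_iff v w).mp hvw).elim id fun h' => ?_
      exact absurd ⟨h.1.symm, w, v, rfl, rfl, h'⟩ (hD.isOrientation_quotientDigraph.2 _ _ h)
  · intro h
    by_cases hvw : connectedComponentMk (fromEdgeSet (tieGraph D).edgeSet) v =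
        connectedComponentMk (fromEdgeSet (tieGraph D).edgeSet) w
    · exact Or.inl ((isFlat_iff_forall_adj.mp hD.isFlat_edgeSet_tieGraph).2
        (ConnectedComponent.exact hvw) (hD.adj h))
    · exact Or.inr ⟨hD.adj h, hvw, v, w, rfl, rfl, h⟩

end IsWeakOrientation

theorem numAcyclicOrientations_contract {F : Set (Sym2 V)} (hF : G.IsFlat F) :
    (G.contract F).numAcyclicOrientations =
      Nat.card {D // IsWeakOrientation G D ∧ (tieGraph D).edgeSet = F} :=
  Nat.card_congr
    { toFun := fun ⟨O, hO, hc⟩ =>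
        ⟨liftRel G F O, isWeakOrientation_liftRel hF hO hc, edgeSet_tieGraph_liftRel hF.1 hO⟩
      invFun := fun ⟨D, hD⟩ => ⟨quotientDigraph F D, by
        obtain ⟨hD, rfl⟩ := hD
        exact ⟨hD.isOrientation_quotientDigraph, hD.not_transGen_quotientDigraph⟩⟩
      left_inv := fun ⟨O, hO, hc⟩ => Subtype.ext (quotientDigraph_liftRel hO)
      right_inv := fun ⟨D, hD, hF⟩ => Subtype.ext (by
        subst hF
        exact hD.liftRel_quotientDigraph) }

theorem weakOrientationSum_univ [Fintype V] (G : SimpleGraph V) :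
    weakOrientationSum G Finset.univ = ∑ F ∈ G.flats,
      (-1 : ℤ) ^ numComponents F * ((G.contract F).numAcyclicOrientations : ℤ) := by
  classical
  have hmaps : ∀ D ∈ ({D | IsWeakOrientation G D} : Finset (V → V → Prop)),
      (tieGraph D).edgeSet ∈ G.flats := fun D hD => by
    simpa [flats] using (Finset.mem_filter.mp hD).2.isFlat_edgeSet_tieGraph
  rw [weakOrientationSum, Finset.coe_univ, spanningCoe_induce_univ,
    ← Finset.sum_fiberwise_of_maps_to hmaps]
  refine Finset.sum_congr rfl fun F hF => ?_
  have hF : G.IsFlat F := by simpa [flats] using hF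
  rw [numAcyclicOrientations_contract hF, Finset.filter_filter, mul_comm, ← nsmul_eq_mul,
    Nat.card_eq_fintype_card, Fintype.card_subtype]
  refine Finset.sum_eq_card_nsmul fun D hD => ?_
  rw [← (Finset.mem_filter.mp hD).2.2, numComponents_edgeSet]

theorem sum_flats_eq [Fintype V] (G : SimpleGraph V) :
    ∑ F ∈ G.flats, (-1 : ℤ) ^ numComponents F * ((G.contract F).numAcyclicOrientations : ℤ) =
      (-1) ^ Fintype.card V := by
  rw [← weakOrientationSum_univ, weakOrientationSum_eq, Finset.card_univ]

end WeakOrientations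

theorem mainTheorem4 {V : Type*} [Fintype V] (Γ : AbstractSimplicialComplex V) (n : ℕ)
    (hn : Fintype.card V = n) :
    (-1 : ℤ) ^ n = ∑ F ∈ Γ.oneSkeleton.flats,
        (-1 : ℤ) ^ SimpleGraph.numComponents F *
          ((Γ.oneSkeleton.contract F).numAcyclicOrientations : ℤ) ∧
    ∀ (𝕜 : Type*) [Field 𝕜],
      ComplexAlgebra.coeffSum 𝕜
        (HopfAlgebra.antipode 𝕜 (ComplexAlgebra.basis 𝕜 Γ)) = (-1 : 𝕜) ^ n := by
  subst hn
  exact ⟨(sum_flats_eq _).symm, fun 𝕜 _ => ComplexAlgebra.coeffSum_antipode_basis 𝕜 Γ⟩
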